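/- For a real number $x$ write $\|x\|=\min_{m\in\mathbb Z}|x-m|$, and for integers $k\ge 1$, $d\ge 2$ put $$\gamma(k,d)=\frac{d^{\lfloor \log_d(k+1)\rfloor}-1}{d}.$$ Then $\gamma(k,d)\ge \frac{k-d+1}{d^2}$ for all integers $k\ge1$, $d\ge2$, and there are effective constants $C_{k,d}>0$ (that is, one may take $C_{k,d}$ to be positive integers given by a computable function of the pair $(k,d)$) with the following property. For all integers $k\ge 1$ and $d\ge 2$, every real number $\alpha$ and every integer $n\ge 1$ there are integers $1\le b_1,\dots,b_k\le n$ with $$\Bigl\|\sum_{j=1}^k b_j^{1/d}-\alpha\Bigr\|\le C_{k,d}\, n^{-\gamma(k,d)} .$$ In particular, for $d=2$: for every integer $k\ge1$, every real $\alpha$ and every integer $n\ge1$ there are integers $1\le b_1,\dots,b_k\le n$ with $\bigl\|\sum_{j=1}^k \sqrt{b_j}-\alpha\bigr\|\le C_{k,2}\, n^{-(k-1)/4}$. -/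

import Mathlib

/-- The distance `‖x‖` from a real number `x` to the nearest integer. -/
noncomputable def distNearestInt (x : ℝ) : ℝ := |x - (round x : ℝ)|

/-- `‖x‖` is the minimum of `|x - m|` over the integers `m`. -/
theorem distNearestInt_isLeast (x : ℝ) :
    IsLeast (Set.range fun m : ℤ => |x - (m : ℝ)|) (distNearestInt x) := by
  refine ⟨⟨round x, rfl⟩, ?_⟩
  rintro _ ⟨m, rfl⟩
  exact round_le x m

/-- The exponent `γ(k, d) = (d ^ ⌊log_d (k + 1)⌋ - 1) / d`. -/
noncomputable def gammaExp (k d : ℕ) : ℝ :=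
  ((d : ℝ) ^ (⌊Real.logb (d : ℝ) ((k : ℝ) + 1)⌋ : ℤ) - 1) / (d : ℝ)

/-! Let `m = ⌊log_d (k+1)⌋`. The `d^m` monomials `θ_e`, `e ∈ (ℤ/d)^m`, in the `d`-th roots of `m`
primes are independent over `ℚ`, and a product of two is a natural multiple of a third. Dirichlet
gives a nonzero `x = ∑ a_e θ_e` with `a_e = O(N)` and `|x| ≤ N^{-(d^m-1)}`. The multiples `x θ_f`
are equally small, and their coordinate vectors form a nonsingular integer matrix, since
multiplication by `x` is injective. Rounding the coordinates of `(α, 0, …, 0)` in this basis gives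
an integer combination of the `θ_e` within `O(N^{-(d^m-1)})` of `α`, with `O(N)` coefficients off
`θ_0 = 1` (`exists_int_comb_near`). Modulo 1 the term at `θ_0` drops out. The other `d^m - 1 ≤ k`
terms, shifted to positive coefficients `c`, are `d`-th roots of integers `c^d θ_e^d = O(N^d)`, so
`N ≍ n^{1/d}` gives the exponent. -/

/-! ### Linear independence of real radicals -/

open Polynomial in
/-- The minimal polynomial of a positive real `d`-th root of a rational is a pure binomial. -/
theorem minpoly_eq_of_pow_eq_ratCast {x : ℝ} (hx : 0 < x) {d : ℕ} (hd : d ≠ 0) {a : ℚ}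
    (ha : x ^ d = a) :
    ∃ c : ℚ, minpoly ℚ x = X ^ (minpoly ℚ x).natDegree - C c := by
  have hint : IsIntegral ℚ x :=
    ⟨X ^ d - C a, monic_X_pow_sub_C a hd, by simp [ha]⟩
  set f := minpoly ℚ x with hf
  have hmon : f.Monic := minpoly.monic hint
  have hdvd : f ∣ X ^ d - C a := minpoly.dvd ℚ x (by simp [ha])
  have hsplit : (f.map (algebraMap ℚ ℂ)).Splits := IsAlgClosed.splits _
  have hcoeff := hsplit.coeff_zero_eq_prod_roots_of_monic (hmon.map _)
  -- All conjugates of `x` are roots of `X^d - a`, hence have modulus `x`. So `x ^ deg f = |f(0)|`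
  -- is rational, which yields a binomial of minimal degree vanishing at `x`.
  have hroot : ∀ z ∈ (f.map (algebraMap ℚ ℂ)).roots, ‖z‖ = x := by
    intro z hz
    have h1 : aeval z f = 0 := by
      have := (mem_roots'.1 hz).2
      rwa [IsRoot, eval_map_algebraMap] at this
    obtain ⟨g, hg⟩ := hdvd
    have h2 : aeval z (X ^ d - C a : ℚ[X]) = 0 := by rw [hg, map_mul, h1, zero_mul]
    have h3 : z ^ d = (a : ℂ) := by simpa [sub_eq_zero] using h2
    have h4 : ‖z‖ ^ d = x ^ d := by
      rw [← norm_pow, h3, ha, Complex.norm_ratCast, abs_of_pos]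
      rw [← ha]; positivity
    exact (pow_left_inj₀ (norm_nonneg z) hx.le hd).1 h4
  have hnorm : |((f.coeff 0 : ℚ) : ℝ)| = x ^ f.natDegree := by
    have h5 : (f.map (algebraMap ℚ ℂ)).roots.card = f.natDegree := by
      rw [← hsplit.natDegree_eq_card_roots, natDegree_map]
    have h6 := congrArg norm hcoeff
    have h9 : ‖(f.map (algebraMap ℚ ℂ)).roots.prod‖
        = ((f.map (algebraMap ℚ ℂ)).roots.map fun z => ‖z‖).prod :=
      (Multiset.prod_hom _ (normHom : ℂ →*₀ ℝ)).symm
    rw [norm_mul, norm_pow, norm_neg, norm_one, one_pow, one_mul, coeff_map, h9] at h6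
    have h7 : (f.map (algebraMap ℚ ℂ)).roots.map (fun z => ‖z‖)
        = Multiset.replicate f.natDegree x := by
      rw [← h5, Multiset.eq_replicate]
      refine ⟨by simp, ?_⟩
      intro y hy
      obtain ⟨z, hz, rfl⟩ := Multiset.mem_map.1 hy
      exact hroot z hz
    rw [← Multiset.prod_replicate, ← h7]
    simpa using h6
  refine ⟨|f.coeff 0|, ?_⟩
  have hpos : 0 < f.natDegree := minpoly.natDegree_pos hint
  refine (minpoly.unique' ℚ x (monic_X_pow_sub_C _ hpos.ne') ?_ ?_).symm
  · simp [← hnorm]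
  · intro q hq
    by_contra! h
    have h8 := minpoly.degree_le_of_ne_zero ℚ x h.1 h.2
    rw [degree_X_pow_sub_C hpos] at hq
    rw [← hf, degree_eq_natDegree hmon.ne_zero] at h8
    exact absurd hq (not_lt.2 h8)

/-- An irrational positive real `d`-th root of a rational has trace zero. -/
theorem trace_eq_zero_of_pow_eq_ratCast (L : IntermediateField ℚ ℝ) [FiniteDimensional ℚ L]
    (x : L) (hx : 0 < (x : ℝ)) {d : ℕ} (hd : d ≠ 0) {a : ℚ} (ha : (x : ℝ) ^ d = a)
    (hirr : Irrational (x : ℝ)) : Algebra.trace ℚ L x = 0 := by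
  obtain ⟨c, hc⟩ := minpoly_eq_of_pow_eq_ratCast hx hd ha
  have hxx : minpoly ℚ (x : ℝ) = minpoly ℚ x := (IntermediateField.minpoly_eq x).symm
  rw [trace_eq_finrank_mul_minpoly_nextCoeff]
  rw [hxx] at hc
  have hint : IsIntegral ℚ x := IsIntegral.of_finite ℚ x
  have h1 : (minpoly ℚ x).natDegree ≠ 1 := by
    intro h
    rw [minpoly.natDegree_eq_one_iff] at h
    obtain ⟨y, hy⟩ := h
    refine hirr ⟨y, ?_⟩
    rw [← hy]; rfl
  have h2 : 1 < (minpoly ℚ x).natDegree := by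
    have := minpoly.natDegree_pos hint
    omega
  rw [Polynomial.nextCoeff, if_neg (by omega), hc]
  have h3 := Polynomial.natDegree_X_pow_sub_C (n := (minpoly ℚ x).natDegree) (r := c)
  rw [h3, Polynomial.coeff_sub, Polynomial.coeff_X_pow, Polynomial.coeff_C]
  rw [if_neg (by omega), if_neg (by omega)]
  simp

/-- Positive reals with rational `d`-th powers and pairwise irrational quotients are linearly
independent over `ℚ`. -/
theorem linearIndependent_of_pow_eq_ratCast {I : Type*} [Finite I] (θ : I → ℝ)
    (hpos : ∀ e, 0 < θ e) {d : ℕ} (hd : d ≠ 0) (hrat : ∀ e, ∃ a : ℚ, θ e ^ d = a)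
    (hirr : ∀ e f, e ≠ f → Irrational (θ e / θ f)) : LinearIndependent ℚ θ := by
  cases nonempty_fintype I
  rw [Fintype.linearIndependent_iff]
  intro g hg f
  let L := IntermediateField.adjoin ℚ (Set.range θ)
  have hint : ∀ x ∈ Set.range θ, IsIntegral ℚ x := by
    rintro _ ⟨e, rfl⟩
    obtain ⟨a, ha⟩ := hrat e
    exact ⟨Polynomial.X ^ d - Polynomial.C a, Polynomial.monic_X_pow_sub_C a hd, by simp [ha]⟩
  have : FiniteDimensional ℚ L :=
    IntermediateField.finiteDimensional_adjoin hint
  let η : I → L := fun e => ⟨θ e, IntermediateField.subset_adjoin ℚ _ ⟨e, rfl⟩⟩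
  -- After division by `θ f`, the trace kills every term except `e = f`.
  have h1 : ∑ e, g e • (η e / η f) = 0 := by
    apply L.val.injective
    have h2 : (∑ e, g e • θ e) / θ f = 0 := by rw [hg, zero_div]
    rw [Finset.sum_div] at h2
    rw [map_zero, map_sum, ← h2]
    refine Finset.sum_congr rfl fun e _ => ?_
    simp [η, Algebra.smul_def, mul_div_assoc]
  have h3 := congrArg (Algebra.trace ℚ L) h1
  rw [map_sum, map_zero, Finset.sum_eq_single f] at h3
  · have hf : η f ≠ 0 := fun h => (hpos f).ne' (congrArg Subtype.val h)
    rw [div_self hf, map_smul, smul_eq_mul, mul_eq_zero] at h3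
    refine h3.resolve_right ?_
    rw [← map_one (algebraMap ℚ L), Algebra.trace_algebraMap]
    simp [Module.finrank_pos.ne']
  · intro e _ hef
    obtain ⟨a, ha⟩ := hrat e
    obtain ⟨b, hb⟩ := hrat f
    rw [map_smul, trace_eq_zero_of_pow_eq_ratCast L (η e / η f) (d := d) (a := a / b) _ hd _ _,
      smul_zero]
    · exact div_pos (hpos e) (hpos f)
    · change (θ e / θ f) ^ d = _
      rw [div_pow, ha, hb]; push_cast; rfl
    · exact hirr e f hef
  · simp

/-! ### Homogeneous and inhomogeneous approximation -/

theorem abs_sum_le_card_mul {J : Type*} [Fintype J] {F : J → ℝ} {c : ℝ} (h : ∀ j, |F j| ≤ c) :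
    |∑ j, F j| ≤ Fintype.card J * c := by
  refine (Finset.abs_sum_le_sum_abs _ _).trans ?_
  rw [← nsmul_eq_mul, ← Finset.card_univ]
  exact Finset.sum_le_card_nsmul _ _ _ fun j _ => h j

/-- Dirichlet's theorem on small values of an inhomogeneous linear form, by pigeonhole. -/
theorem exists_int_small_linear_form {J : Type*} [Fintype J] [Nonempty J] (θ : J → ℝ) {N : ℕ} (hN : 1 ≤ N) :
    ∃ (a : J → ℤ) (z : ℤ), a ≠ 0 ∧ (∀ j, |a j| ≤ N) ∧
      |∑ j, (a j : ℝ) * θ j - z| ≤ ((N : ℝ) ^ Fintype.card J)⁻¹ := by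
  classical
  let M := N ^ Fintype.card J
  have hM : 0 < (M : ℝ) := by positivity
  let s : Finset (J → ℕ) := Fintype.piFinset fun _ => Finset.range (N + 1)
  let v : (J → ℕ) → ℝ := fun c => ∑ j, (c j : ℝ) * θ j
  -- There are `(N+1)^|J|` vectors but only `N^|J|` boxes of length `1/M`.
  have hcard : (Finset.range M).card < s.card := by
    simp only [s, Fintype.card_piFinset, Finset.card_range, Finset.prod_const, Finset.card_univ]
    exact Nat.pow_lt_pow_left (Nat.lt_succ_self N) Fintype.card_ne_zero
  have hmaps : Set.MapsTo (fun c => ⌊Int.fract (v c) * M⌋₊) s (Finset.range M) := by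
    intro c _
    simp only [Finset.coe_range, Set.mem_Iio]
    rw [Nat.floor_lt (mul_nonneg (Int.fract_nonneg _) hM.le)]
    exact mul_lt_of_lt_one_left hM (Int.fract_lt_one _)
  obtain ⟨c, hc, c', hc', hne, heq⟩ := Finset.exists_ne_map_eq_of_card_lt_of_maps_to hcard hmaps
  refine ⟨fun j => (c j : ℤ) - c' j, ⌊v c⌋ - ⌊v c'⌋, ?_, ?_, ?_⟩
  · intro h0
    refine hne (funext fun j => ?_)
    have := congrFun h0 j
    simp only [Pi.zero_apply] at this
    omega
  · intro j
    have h1 := Finset.mem_range.1 (Fintype.mem_piFinset.1 hc j)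
    have h2 := Finset.mem_range.1 (Fintype.mem_piFinset.1 hc' j)
    dsimp only
    rw [abs_le]
    constructor <;> omega
  · have h1 : ∑ j, (((c j : ℤ) - c' j : ℤ) : ℝ) * θ j - ((⌊v c⌋ - ⌊v c'⌋ : ℤ) : ℝ)
        = Int.fract (v c) - Int.fract (v c') := by
      simp only [Int.fract, v]
      push_cast
      simp only [sub_mul, Finset.sum_sub_distrib]
      ring
    rw [h1]
    have h2 := Nat.floor_le (mul_nonneg (Int.fract_nonneg (v c)) hM.le)
    have h3 := Nat.lt_floor_add_one (Int.fract (v c) * M)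
    have h4 := Nat.floor_le (mul_nonneg (Int.fract_nonneg (v c')) hM.le)
    have h5 := Nat.lt_floor_add_one (Int.fract (v c') * M)
    rw [heq] at h2 h3
    have h6 : |(Int.fract (v c) - Int.fract (v c')) * M| ≤ 1 := by
      rw [abs_le]; constructor <;> linarith
    rw [abs_mul, abs_of_pos hM] at h6
    rw [← one_div, le_div_iff₀ (by positivity)]
    simpa [M] using h6

/-- Every real vector is within the sum of the sizes of `v f` of an integer combination of the
`v f`, if these are the rows of a nonsingular integer matrix. -/
theorem exists_int_vecMul_near {I : Type*} [Fintype I] [DecidableEq I] (M : Matrix I I ℤ)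
    (hM : M.det ≠ 0) (y : I → ℝ) :
    ∃ (r : I → ℤ) (t : I → ℝ), (∀ f, |(r f : ℝ) - t f| ≤ 1) ∧
      ∀ e, ∑ f, (r f : ℝ) * M f e - y e = ∑ f, ((r f : ℝ) - t f) * M f e := by
  have h1 : IsUnit (M.map (Int.cast : ℤ → ℝ)) := by
    rw [Matrix.isUnit_iff_isUnit_det, isUnit_iff_ne_zero]
    have : (M.map (Int.cast : ℤ → ℝ)).det = (M.det : ℝ) := ((Int.castRingHom ℝ).map_det M).symm
    rw [this]
    exact_mod_cast hM
  obtain ⟨t, ht⟩ := Matrix.vecMul_surjective_iff_isUnit.2 h1 y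
  refine ⟨fun f => round (t f), t, fun f => ?_, fun e => ?_⟩
  · rw [abs_sub_comm]
    exact (abs_sub_round (t f)).trans (by norm_num)
  · have : y e = ∑ f, t f * M f e := by rw [← ht]; rfl
    rw [this, ← Finset.sum_sub_distrib]
    simp only [sub_mul]

/-- Inhomogeneous approximation by integer combinations of a `ℚ`-linearly independent family `θ`
that is closed under multiplication up to natural factors. -/
theorem exists_int_comb_near {I : Type*} [Fintype I] [AddCommGroup I] (θ : I → ℝ)
    (hθ0 : θ 0 = 1) (q : I → I → ℕ) (hmul : ∀ h f, θ h * θ f = q h f * θ (h + f))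
    (hind : LinearIndependent ℚ θ) {D B N : ℕ} (hD : Fintype.card I ≤ D)
    (hθ : ∀ e, 1 ≤ θ e) (hθB : ∀ e, θ e ≤ B) (hqB : ∀ h f, q h f ≤ B) (hN : 1 ≤ N) (α : ℝ) :
    ∃ a : I → ℤ, (∀ e, e ≠ 0 → |a e| ≤ D ^ 2 * B ^ 2 * N) ∧
      |∑ e, (a e : ℝ) * θ e - α| ≤ D * B * ((N : ℝ) ^ (Fintype.card I - 1))⁻¹ := by
  classical
  have hindZ : ∀ g : I → ℤ, ∑ e, (g e : ℝ) * θ e = 0 → g = 0 := by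
    intro g hg
    have := Fintype.linearIndependent_iff.1 hind (fun e => (g e : ℚ))
      (by rw [← hg]; exact Finset.sum_congr rfl fun e _ => by simp [Algebra.smul_def])
    funext e
    exact_mod_cast this e
  have hB1 : (1 : ℝ) ≤ B := (hθ 0).trans (hθB 0)
  have hN1 : (1 : ℝ) ≤ N := by exact_mod_cast hN
  have hDR : (Fintype.card I : ℝ) ≤ D := by exact_mod_cast hD
  have hcardpos : (1 : ℝ) ≤ Fintype.card I := by exact_mod_cast Fintype.card_pos (α := I)
  have hD1 : (1 : ℝ) ≤ D := hcardpos.trans hDR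
  have hsplit : ∀ F : I → ℝ, ∑ e, F e = F 0 + ∑ j : {e : I // e ≠ 0}, F j := by
    intro F
    rw [← Finset.sum_subtype (Finset.univ.erase 0) (by simp), Finset.add_sum_erase _ _ (by simp)]
  have hcardJ : Fintype.card {e : I // e ≠ 0} = Fintype.card I - 1 := by
    simp [Fintype.card_subtype_compl]
  obtain ⟨a, ha0, haN, hax⟩ : ∃ a : I → ℤ, a ≠ 0 ∧ (∀ e, |(a e : ℝ)| ≤ D * B * N) ∧
      |∑ e, (a e : ℝ) * θ e| ≤ ((N : ℝ) ^ (Fintype.card I - 1))⁻¹ := by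
    -- If `0` is the only index, Dirichlet's theorem has no variables and `x = 1` serves.
    rcases isEmpty_or_nonempty {e : I // e ≠ 0} with hemp | hne
    rotate_left
    · obtain ⟨a, z, hane, haN, hsmall⟩ :=
        exists_int_small_linear_form (fun j : {e : I // e ≠ 0} => θ j) hN
      let a' : I → ℤ := fun e => if h : e = 0 then -z else a ⟨e, h⟩
      have ha0 : a' 0 = -z := by simp [a']
      have haj : ∀ j : {e : I // e ≠ 0}, a' j = a j := fun j => by simp [a', j.2]
      have haNR : ∀ j, |(a j : ℝ)| ≤ N := fun j => by exact_mod_cast haN j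
      have hpow : ((N : ℝ) ^ Fintype.card {e : I // e ≠ 0})⁻¹ ≤ 1 :=
        inv_le_one_of_one_le₀ (one_le_pow₀ hN1)
      have hsumle : |∑ j, (a j : ℝ) * θ j| ≤ (Fintype.card I - 1) * (N * B) := by
        refine (abs_sum_le_card_mul (c := N * B) fun j => ?_).trans ?_
        · rw [abs_mul, abs_of_pos (zero_lt_one.trans_le (hθ j))]
          exact mul_le_mul (haNR j) (hθB j) (zero_le_one.trans (hθ j)) (by positivity)
        · rw [hcardJ, Nat.cast_sub Fintype.card_pos, Nat.cast_one]
      refine ⟨a', ?_, ?_, ?_⟩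
      · rintro h
        exact hane (funext fun j => by rw [← haj j, h]; rfl)
      · intro e
        by_cases he : e = 0
        · subst he
          have h1 : |(z : ℝ)| ≤ |∑ j, (a j : ℝ) * θ j| + 1 := by
            have := abs_sub_abs_le_abs_sub (z : ℝ) (∑ j, (a j : ℝ) * θ j)
            rw [abs_sub_comm (z : ℝ)] at this
            linarith
          rw [ha0]
          push_cast
          rw [abs_neg]
          have h2 : (1 : ℝ) ≤ N * B := one_le_mul_of_one_le_of_one_le hN1 hB1
          calc |(z : ℝ)| ≤ (Fintype.card I - 1) * (N * B) + N * B := by linarith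
            _ = Fintype.card I * (N * B) := by ring
            _ ≤ D * (N * B) := by gcongr
            _ = D * B * N := by ring
        · rw [haj ⟨e, he⟩]
          refine (haNR _).trans ?_
          exact le_mul_of_one_le_left (by positivity) (one_le_mul_of_one_le_of_one_le hD1 hB1)
      · rw [hsplit, ha0, hθ0]
        simp only [haj]
        rw [hcardJ] at hsmall
        refine le_trans (le_of_eq ?_) hsmall
        congr 1
        push_cast
        ring
    · have hc : Fintype.card I - 1 = 0 := by rw [← hcardJ, Fintype.card_eq_zero]
      refine ⟨Pi.single 0 1, ?_, ?_, ?_⟩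
      · simp
      · intro e
        refine le_trans (b := (1 : ℝ)) ?_ ?_
        · by_cases he : e = 0
          · subst he; simp
          · simp [he]
        · exact one_le_mul_of_one_le_of_one_le (one_le_mul_of_one_le_of_one_le hD1 hB1) hN1
      · rw [hsplit, hc, hθ0]
        simp
  set x := ∑ e, (a e : ℝ) * θ e with hx
  have hx0 : x ≠ 0 := fun h => ha0 (hindZ a h)
  -- Row `f` holds the coordinates of `x * θ f`.
  let M : Matrix I I ℤ := fun f e => a (e - f) * q (e - f) f
  have hMrow : ∀ f, ∑ e, (M f e : ℝ) * θ e = x * θ f := by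
    intro f
    rw [hx, Finset.sum_mul, ← Equiv.sum_comp (Equiv.addRight f)]
    refine Finset.sum_congr rfl fun e _ => ?_
    simp only [Equiv.coe_addRight, M, add_sub_cancel_right]
    push_cast
    rw [mul_assoc, mul_assoc, hmul]
  have hdet : M.det ≠ 0 := by
    rw [Ne, ← Matrix.exists_vecMul_eq_zero_iff]
    rintro ⟨v, hv0, hv⟩
    refine hv0 (hindZ v ?_)
    have h1 : x * ∑ f, (v f : ℝ) * θ f = 0 := by
      calc x * ∑ f, (v f : ℝ) * θ f = ∑ f, (v f : ℝ) * ∑ e, (M f e : ℝ) * θ e := by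
            rw [Finset.mul_sum]
            exact Finset.sum_congr rfl fun f _ => by rw [hMrow]; ring
        _ = ∑ e, (((Matrix.vecMul v M) e : ℤ) : ℝ) * θ e := by
            simp only [Matrix.vecMul, dotProduct, Finset.mul_sum]
            push_cast
            simp only [Finset.sum_mul]
            rw [Finset.sum_comm]
            exact Finset.sum_congr rfl fun f _ => Finset.sum_congr rfl fun e _ => by ring
        _ = 0 := by simp [hv]
    exact (mul_eq_zero.1 h1).resolve_left hx0
  -- Rounding moves the zero entries by `O(N)`, but the value at `θ` only by `∑ (r f - t f) x θ f`,
  -- which is small with `x`.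
  obtain ⟨r, t, hrt, hr⟩ := exists_int_vecMul_near M hdet (Pi.single 0 α)
  have hMle : ∀ f e, |(M f e : ℝ)| ≤ D * B * N * B := by
    intro f e
    simp only [M]
    push_cast
    rw [abs_mul, Nat.abs_cast]
    have := hqB (e - f) f
    exact mul_le_mul (haN _) (by exact_mod_cast this) (by positivity) (by positivity)
  refine ⟨fun e => ∑ f, r f * M f e, ?_, ?_⟩
  · intro e he
    have h1 := hr e
    rw [Pi.single_eq_of_ne he, sub_zero] at h1
    have h2 : |((∑ f, r f * M f e : ℤ) : ℝ)| ≤ D ^ 2 * B ^ 2 * N := by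
      push_cast
      rw [h1]
      refine (abs_sum_le_card_mul (c := D * B * N * B) fun f => ?_).trans ?_
      · rw [abs_mul]
        exact (mul_le_of_le_one_left (abs_nonneg _) (hrt f)).trans (hMle f e)
      · calc (Fintype.card I : ℝ) * (D * B * N * B) ≤ D * (D * B * N * B) := by gcongr
          _ = D ^ 2 * B ^ 2 * N := by ring
    exact_mod_cast h2
  · have h1 : ∑ e, ((∑ f, r f * M f e : ℤ) : ℝ) * θ e - α
        = ∑ f, ((r f : ℝ) - t f) * (x * θ f) := by
      have h2 : α = ∑ e, (Pi.single 0 α : I → ℝ) e * θ e := by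
        rw [hsplit, hθ0]
        simp only [Pi.single_eq_same, mul_one, left_eq_add]
        exact Finset.sum_eq_zero fun j _ => by rw [Pi.single_eq_of_ne j.2, zero_mul]
      conv_lhs => rw [h2]
      rw [← Finset.sum_sub_distrib]
      simp only [← sub_mul]
      push_cast
      simp only [hr, ← hMrow, Finset.sum_mul, Finset.mul_sum]
      rw [Finset.sum_comm]
      exact Finset.sum_congr rfl fun f _ => Finset.sum_congr rfl fun e _ => by ring
    rw [h1]
    refine (abs_sum_le_card_mul (c := ((N : ℝ) ^ (Fintype.card I - 1))⁻¹ * B) fun f => ?_).trans ?_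
    · rw [abs_mul, abs_mul, abs_of_pos (zero_lt_one.trans_le (hθ f))]
      exact (mul_le_of_le_one_left (mul_nonneg (abs_nonneg _) (zero_le_one.trans (hθ f)))
        (hrt f)).trans (mul_le_mul hax (hθB f) (zero_le_one.trans (hθ f)) (by positivity))
    · calc (Fintype.card I : ℝ) * (((N : ℝ) ^ (Fintype.card I - 1))⁻¹ * B)
          ≤ D * (((N : ℝ) ^ (Fintype.card I - 1))⁻¹ * B) := by gcongr
        _ = D * B * ((N : ℝ) ^ (Fintype.card I - 1))⁻¹ := by ring

/-! ### Radicals of primes -/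

/-- Bertrand's postulate iterated from 2; the explicit size keeps the final constant computable. -/
theorem exists_strictMono_prime_le_two_pow :
    ∃ p : ℕ → ℕ, StrictMono p ∧ ∀ i, (p i).Prime ∧ p i ≤ 2 ^ (i + 1) := by
  choose! next hprime hlt hle using Nat.exists_prime_lt_and_le_two_mul
  let p : ℕ → ℕ := fun i => Nat.rec 2 (fun _ r => next r) i
  have hp : ∀ i, (p i).Prime ∧ p i ≤ 2 ^ (i + 1) := by
    intro i
    induction i with
    | zero => exact ⟨Nat.prime_two, le_rfl⟩
    | succ i ih =>
      refine ⟨hprime _ ih.1.ne_zero, (hle _ ih.1.ne_zero).trans ?_⟩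
      rw [pow_succ' 2 (i + 1)]
      exact Nat.mul_le_mul_left 2 ih.2
  exact ⟨p, strictMono_nat_of_lt_succ fun i => hlt _ (hp i).1.ne_zero, hp⟩

/-- Quotients of distinct monomials in the `d`-th roots of distinct primes are irrational. -/
theorem irrational_prod_radical_div {m d : ℕ} (p : Fin m → ℕ) (hp : ∀ i, (p i).Prime)
    (hinj : Function.Injective p) (ρ : Fin m → ℝ) (hρ : ∀ i, 0 < ρ i)
    (hpow : ∀ i, ρ i ^ d = p i) {u v : Fin m → ℕ} (hu : ∀ i, u i < d) (hv : ∀ i, v i < d)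
    (huv : u ≠ v) : Irrational ((∏ i, ρ i ^ u i) / ∏ i, ρ i ^ v i) := by
  rintro ⟨r, hr⟩
  refine huv (funext fun i => ?_)
  have hpos : ∀ u : Fin m → ℕ, 0 < ∏ i, ρ i ^ u i := fun u =>
    Finset.prod_pos fun i _ => pow_pos (hρ i) _
  have hr0 : r ≠ 0 := by
    rintro rfl
    rw [Rat.cast_zero] at hr
    exact (div_pos (hpos u) (hpos v)).ne hr
  have hdpow : ∀ u : Fin m → ℕ, (∏ i, ρ i ^ u i) ^ d = ((∏ i, (p i : ℚ) ^ u i : ℚ) : ℝ) := by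
    intro u
    push_cast
    rw [← Finset.prod_pow]
    exact Finset.prod_congr rfl fun i _ => by rw [← hpow, ← pow_mul, ← pow_mul, mul_comm]
  have h1 : r ^ d * ∏ i, (p i : ℚ) ^ v i = ∏ i, (p i : ℚ) ^ u i := by
    have h2 : (r : ℝ) * ∏ i, ρ i ^ v i = ∏ i, ρ i ^ u i := by
      rw [hr, div_mul_cancel₀ _ (hpos v).ne']
    have h3 := congrArg (· ^ d) h2
    simp only [mul_pow, hdpow] at h3
    exact_mod_cast h3
  have : Fact (p i).Prime := ⟨hp i⟩
  have hne : ∀ (u : Fin m → ℕ) j, (p j : ℚ) ^ u j ≠ 0 := fun u j =>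
    pow_ne_zero _ (by exact_mod_cast (hp j).ne_zero)
  -- Comparing `p i`-adic valuations in `h1` gives `v i ≡ u i` modulo `d`, and both are below `d`.
  have hval : ∀ u : Fin m → ℕ, padicValRat (p i) (∏ j, (p j : ℚ) ^ u j) = u i := by
    intro u
    have h4 : ∀ s : Finset (Fin m), padicValRat (p i) (∏ j ∈ s, (p j : ℚ) ^ u j)
        = ∑ j ∈ s, padicValRat (p i) ((p j : ℚ) ^ u j) := by
      intro s
      induction s using Finset.cons_induction with
      | empty => simp
      | cons a s ha ih =>
        rw [Finset.prod_cons, Finset.sum_cons, padicValRat.mul (hne u a)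
          (Finset.prod_ne_zero_iff.2 fun j _ => hne u j), ih]
    rw [h4, Finset.sum_eq_single i]
    · rw [padicValRat.pow, padicValRat.self (hp i).one_lt,
        mul_one]
    · intro j _ hj
      have : Fact (p j).Prime := ⟨hp j⟩
      rw [padicValRat.pow, padicValRat.of_nat,
        padicValNat_primes (fun h => hj (hinj h.symm))]
      simp
    · simp
  have h5 := congrArg (padicValRat (p i)) h1
  rw [padicValRat.mul (pow_ne_zero _ hr0) (Finset.prod_ne_zero_iff.2 fun j _ => hne v j),
    padicValRat.pow, hval, hval] at h5
  have h6 : (v i : ℤ) ≡ u i [ZMOD d] := by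
    rw [Int.modEq_iff_dvd]
    exact ⟨padicValRat (p i) r, by linarith⟩
  have h7 : v i ≡ u i [MOD d] := Int.natCast_modEq_iff.1 h6
  exact (Nat.ModEq.eq_of_lt_of_lt h7 (hv i) (hu i)).symm

/-- The monomials in the `d`-th roots of `m` primes, indexed by exponents modulo `d`. -/
theorem exists_radical_family (m d : ℕ) [NeZero d] :
    ∃ (θ : (Fin m → ZMod d) → ℝ) (q : (Fin m → ZMod d) → (Fin m → ZMod d) → ℕ)
      (w : (Fin m → ZMod d) → ℕ),
      θ 0 = 1 ∧ (∀ h f, θ h * θ f = q h f * θ (h + f)) ∧ LinearIndependent ℚ θ ∧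
      (∀ e, 1 ≤ θ e) ∧ (∀ e, θ e ^ d = w e) ∧ (∀ e, w e ≤ 2 ^ (m * m * d)) ∧
      ∀ h f, q h f ≤ 2 ^ (m * m * d) := by
  obtain ⟨P, hmono, hP⟩ := exists_strictMono_prime_le_two_pow
  have hd : d ≠ 0 := NeZero.ne d
  let p : Fin m → ℕ := fun i => P i
  have hp : ∀ i, (p i).Prime := fun i => (hP i).1
  have hple : ∀ i, p i ≤ 2 ^ m := fun i =>
    (hP i).2.trans (Nat.pow_le_pow_right two_pos i.2)
  have hinj : Function.Injective p := hmono.injective.comp Fin.val_injective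
  let ρ : Fin m → ℝ := fun i => (p i : ℝ) ^ ((d : ℝ)⁻¹)
  have hpow : ∀ i, ρ i ^ d = p i := fun i => Real.rpow_inv_natCast_pow (Nat.cast_nonneg _) hd
  have hρ : ∀ i, 1 ≤ ρ i := fun i =>
    Real.one_le_rpow (by exact_mod_cast (hp i).one_le) (by positivity)
  have hρ0 : ∀ i, 0 < ρ i := fun i => zero_lt_one.trans_le (hρ i)
  have hbound : ∀ u : Fin m → ℕ, (∀ i, u i ≤ d) → ∏ i, p i ^ u i ≤ 2 ^ (m * m * d) := by
    intro u hu
    calc ∏ i, p i ^ u i ≤ ∏ _i : Fin m, (2 ^ m) ^ d := by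
          refine Finset.prod_le_prod' fun i _ => ?_
          exact (Nat.pow_le_pow_left (hple i) _).trans
            (Nat.pow_le_pow_right (by positivity) (hu i))
      _ = 2 ^ (m * m * d) := by
          rw [Finset.prod_const, Finset.card_univ, Fintype.card_fin, ← pow_mul, ← pow_mul]
          congr 1
          ring
  have hwpow : ∀ e : Fin m → ZMod d, (∏ i, ρ i ^ (e i).val) ^ d
      = ((∏ i, p i ^ (e i).val : ℕ) : ℝ) := by
    intro e
    push_cast
    rw [← Finset.prod_pow]
    exact Finset.prod_congr rfl fun i _ => by rw [← hpow, ← pow_mul, ← pow_mul, mul_comm]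
  -- Adding exponents modulo `d` can carry; each carry contributes `ρ i ^ d = p i`, which goes into
  -- `q`.
  refine ⟨fun e => ∏ i, ρ i ^ (e i).val, fun h f => ∏ i, p i ^ (((h i).val + (f i).val) / d),
    fun e => ∏ i, p i ^ (e i).val, by simp, ?_, ?_, ?_, hwpow, ?_, ?_⟩
  · intro h f
    push_cast
    rw [← Finset.prod_mul_distrib, ← Finset.prod_mul_distrib]
    refine Finset.prod_congr rfl fun i _ => ?_
    rw [Pi.add_apply, ZMod.val_add, ← hpow, ← pow_add, ← pow_mul, ← pow_add, Nat.div_add_mod]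
  · refine linearIndependent_of_pow_eq_ratCast _ (fun e => Finset.prod_pos fun i _ =>
      pow_pos (hρ0 i) _) hd (fun e => ⟨_, (hwpow e).trans (Rat.cast_natCast _).symm⟩) ?_
    intro e f hef
    refine irrational_prod_radical_div p hp hinj ρ hρ0 hpow (fun i => ZMod.val_lt _)
      (fun i => ZMod.val_lt _) fun h => hef (funext fun i => ?_)
    exact ZMod.val_injective d (congrFun h i)
  · intro e
    exact Finset.one_le_prod fun i _ => one_le_pow₀ (hρ i)
  · exact fun e => hbound _ fun i => (ZMod.val_lt _).le
  · refine fun h f => hbound _ fun i => ?_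
    have h1 := ZMod.val_lt (h i)
    have h2 := ZMod.val_lt (f i)
    refine Nat.lt_succ_iff.1 ((Nat.div_lt_iff_lt_mul (Nat.pos_of_ne_zero hd)).2 ?_)
    nlinarith

/-! ### Explicit constants -/

/-- A power of two bounding all radicals used for the pair `(k, d)`. -/
def radicalBound (k d : ℕ) : ℕ := 2 ^ (k * k * d)

/-- The least `n` for which the approximation argument applies. -/
def rangeThreshold (k d : ℕ) : ℕ :=
  radicalBound k d * (3 * ((k + 1) ^ 2 * radicalBound k d ^ 2)) ^ d

/-- The explicit approximation constant. -/
def approxConst (k d : ℕ) : ℕ := (k + 1) * radicalBound k d * (2 * rangeThreshold k d) ^ k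

theorem computable₂_approxConst : Computable₂ approxConst := by
  have hpow : Primrec₂ ((· ^ ·) : ℕ → ℕ → ℕ) := Primrec₂.unpaired'.1 Nat.Primrec.pow
  have hk : Primrec₂ fun k _ : ℕ => k := Primrec.fst
  have hd : Primrec₂ fun _ d : ℕ => d := Primrec.snd
  have hmul : ∀ {f g : ℕ → ℕ → ℕ}, Primrec₂ f → Primrec₂ g → Primrec₂ fun k d => f k d * g k d :=
    fun hf hg => Primrec.nat_mul.comp hf hg
  have hpw : ∀ {f g : ℕ → ℕ → ℕ}, Primrec₂ f → Primrec₂ g → Primrec₂ fun k d => f k d ^ g k d :=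
    fun hf hg => hpow.comp hf hg
  have hc : ∀ c : ℕ, Primrec₂ fun _ _ : ℕ => c := fun c => Primrec.const c
  have hk1 : Primrec₂ fun k _ : ℕ => k + 1 := Primrec.succ.comp hk
  have hB : Primrec₂ radicalBound := hpw (hc 2) (hmul (hmul hk hk) hd)
  have hG : Primrec₂ rangeThreshold :=
    hmul hB (hpw (hmul (hc 3) (hmul (hpw hk1 (hc 2)) (hpw hB (hc 2)))) hd)
  exact (show Primrec₂ approxConst from
    hmul (hmul hk1 hB) (hpw (hmul (hc 2) hG) hk)).to_comp

/-! ### Sums of radicals -/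

theorem distNearestInt_le (x : ℝ) (z : ℤ) : distNearestInt x ≤ |x - z| :=
  (distNearestInt_isLeast x).2 ⟨z, rfl⟩

theorem rangeThreshold_pos (k d : ℕ) : 0 < rangeThreshold k d := by
  unfold rangeThreshold radicalBound; positivity

/-- Approximation by a sum of `k` integer radicals, in terms of a free coefficient range `N`. -/
theorem exists_radical_sum_near {k d m N n : ℕ} (hd : 2 ≤ d) (hm : d ^ m ≤ k + 1) (hN : 1 ≤ N)
    (hn : N ^ d * rangeThreshold k d ≤ n) (α : ℝ) :
    ∃ b : Fin k → ℕ, (∀ j, 1 ≤ b j ∧ b j ≤ n) ∧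
      distNearestInt ((∑ j, (b j : ℝ) ^ ((1 : ℝ) / (d : ℝ))) - α)
        ≤ (((k + 1) * radicalBound k d : ℕ) : ℝ) * ((N : ℝ) ^ (d ^ m - 1))⁻¹ := by
  have hd0 : d ≠ 0 := by omega
  have : NeZero d := ⟨hd0⟩
  obtain ⟨θ, q, w, hθ0, hmul, hind, hθ1, hθw, hwB, hqB⟩ := exists_radical_family m d
  set B := radicalBound k d with hB
  have hmk : m ≤ k := by
    have h1 : m < 2 ^ m := Nat.lt_two_pow_self
    have h2 : 2 ^ m ≤ d ^ m := Nat.pow_le_pow_left hd m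
    omega
  have hBle : 2 ^ (m * m * d) ≤ B := by
    rw [hB, radicalBound]
    exact Nat.pow_le_pow_right two_pos (by gcongr)
  have hwB' : ∀ e, w e ≤ B := fun e => (hwB e).trans hBle
  have hθB : ∀ e, θ e ≤ B := fun e =>
    (le_self_pow₀ (hθ1 e) hd0).trans (by rw [hθw]; exact_mod_cast hwB' e)
  have hcard : Fintype.card (Fin m → ZMod d) = d ^ m := by simp [ZMod.card]
  set T := (k + 1) ^ 2 * B ^ 2 with hT
  have hBpos : 0 < B := by rw [hB, radicalBound]; positivity
  have hTN : 1 ≤ T * N := Nat.mul_pos (by positivity) hN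
  -- As `|a e| ≤ T N`, the shift gives `1 ≤ a e + S ≤ 2 T N + 1 ≤ 3 T N`, whence the 3 in
  -- `rangeThreshold`. Subtracting `∑ S θ_j` from the target compensates for it.
  let S : ℤ := T * N + 1
  let J := {e : Fin m → ZMod d // e ≠ 0}
  obtain ⟨a, ha, hnear⟩ := exists_int_comb_near θ hθ0 q hmul hind (D := k + 1) (by rwa [hcard])
    hθ1 hθB (fun h f => (hqB h f).trans hBle) hN (α - ∑ j : J, (S : ℝ) * θ j)
  rw [hcard] at hnear
  have haT : ∀ e, e ≠ 0 → |a e| ≤ T * N := by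
    intro e he
    refine (ha e he).trans (le_of_eq ?_)
    rw [hT]; push_cast; ring
  let c : J → ℕ := fun j => (a j + S).toNat
  have hc : ∀ j, (c j : ℤ) = a j + S := by
    intro j
    refine Int.toNat_of_nonneg ?_
    have := (abs_le.1 (haT j j.2)).1
    simp only [S]
    linarith
  have hc1 : ∀ j, 1 ≤ c j := by
    intro j
    have h1 := (abs_le.1 (haT j j.2)).1
    have h2 := hc j
    simp only [S] at h2
    zify
    linarith
  have hcT : ∀ j, c j ≤ 3 * T * N := by
    intro j
    have h1 := (abs_le.1 (haT j j.2)).2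
    have h2 := hc j
    simp only [S] at h2
    zify at hTN ⊢
    linarith
  -- The spare radicands are set to 1 and add the integer `r`.
  let r := k - (d ^ m - 1)
  have hdm : 1 ≤ d ^ m := Nat.one_le_pow _ _ (by omega)
  have hcardJ : Fintype.card J = d ^ m - 1 := by
    rw [← hcard]
    simp [J, Fintype.card_subtype_compl]
  let E : Fin k ≃ J ⊕ Fin r := Fintype.equivOfCardEq (by
    rw [Fintype.card_sum, hcardJ, Fintype.card_fin, Fintype.card_fin]; omega)
  let b' : J ⊕ Fin r → ℕ := Sum.elim (fun j => c j ^ d * w j) fun _ => 1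
  have hw1 : ∀ e, 1 ≤ w e := by
    intro e
    have : (1 : ℝ) ≤ w e := by rw [← hθw]; exact one_le_pow₀ (hθ1 e)
    exact_mod_cast this
  have hn1 : 1 ≤ n := le_trans (Nat.mul_pos (by positivity) (rangeThreshold_pos k d)) hn
  refine ⟨fun j => b' (E j), fun j => ?_, ?_⟩
  · change 1 ≤ b' (E j) ∧ b' (E j) ≤ n
    rcases E j with j | j
    · refine ⟨Nat.mul_pos (pow_pos (hc1 j) d) (hw1 j), le_trans ?_ hn⟩
      calc c j ^ d * w j ≤ (3 * T * N) ^ d * B :=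
            Nat.mul_le_mul (Nat.pow_le_pow_left (hcT j) d) (hwB' j)
        _ = N ^ d * rangeThreshold k d := by
            rw [rangeThreshold, ← hB, ← hT, mul_pow]; ring
    · exact ⟨le_rfl, hn1⟩
  · have hroot : ∀ j : J, ((b' (Sum.inl j) : ℕ) : ℝ) ^ ((1 : ℝ) / d) = c j * θ j := by
      intro j
      have h1 : ((b' (Sum.inl j) : ℕ) : ℝ) = (c j * θ j) ^ d := by
        simp only [b', Sum.elim_inl]
        push_cast
        rw [mul_pow, hθw]
      rw [h1, one_div, Real.pow_rpow_inv_natCast _ hd0]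
      exact mul_nonneg (Nat.cast_nonneg _) (zero_le_one.trans (hθ1 j))
    have hsum : ∑ j, ((b' (E j) : ℕ) : ℝ) ^ ((1 : ℝ) / d) = ∑ j : J, (c j : ℝ) * θ j + r := by
      rw [Equiv.sum_comp E (fun s => ((b' s : ℕ) : ℝ) ^ ((1 : ℝ) / d)), Fintype.sum_sum_type]
      simp only [hroot]
      simp [b']
    have hsplit : ∑ e, (a e : ℝ) * θ e = a 0 + ∑ j : J, (a j : ℝ) * θ j := by
      rw [← Finset.sum_subtype (Finset.univ.erase 0) (by simp) (fun e => (a e : ℝ) * θ e),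
        ← Finset.add_sum_erase Finset.univ _ (Finset.mem_univ 0), hθ0, mul_one]
    refine (distNearestInt_le _ ((r : ℤ) - a 0)).trans ?_
    rw [hsum]
    refine le_trans (le_of_eq ?_) (hnear.trans (le_of_eq ?_))
    · rw [hsplit]
      have hcR : ∀ j, (c j : ℝ) = a j + S := fun j => by exact_mod_cast hc j
      simp only [hcR, add_mul, Finset.sum_add_distrib]
      congr 1
      push_cast
      ring
    · push_cast; ring

/-- For `n ≥ G` take `N = ⌊(n/G)^{1/d}⌋`; the floor costs at most a factor 2 in `N`, hence `2^k` in
the constant. For `n < G` the bound exceeds 1 and any radicands do. -/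
theorem exists_radical_sum_near_rpow {k d m n : ℕ} (hd : 2 ≤ d) (hm : d ^ m ≤ k + 1) (hn : 1 ≤ n)
    (α : ℝ) :
    ∃ b : Fin k → ℕ, (∀ j, 1 ≤ b j ∧ b j ≤ n) ∧
      distNearestInt ((∑ j, (b j : ℝ) ^ ((1 : ℝ) / (d : ℝ))) - α)
        ≤ (approxConst k d : ℝ) * (n : ℝ) ^ (-(((d : ℝ) ^ m - 1) / d)) := by
  set G := rangeThreshold k d with hG
  have hGpos : 0 < G := rangeThreshold_pos k d
  have hG1 : (1 : ℝ) ≤ G := by exact_mod_cast hGpos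
  have hnR : (1 : ℝ) ≤ n := by exact_mod_cast hn
  have hn0 : (0 : ℝ) < n := by linarith
  have hdR : (2 : ℝ) ≤ d := by exact_mod_cast hd
  have hdm : 1 ≤ d ^ m := Nat.one_le_pow _ _ (by omega)
  set K := d ^ m - 1 with hK
  have hKR : (d : ℝ) ^ m - 1 = K := by rw [hK, Nat.cast_sub hdm]; push_cast; ring
  have hKk : K ≤ k := by omega
  rw [hKR]
  have hGpow : (G : ℝ) ^ ((K : ℝ) / d) ≤ G ^ k := by
    rw [← Real.rpow_natCast]
    refine Real.rpow_le_rpow_of_exponent_le hG1 ?_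
    calc (K : ℝ) / d ≤ K := div_le_self (by positivity) (by linarith)
      _ ≤ k := by exact_mod_cast hKk
  have hA1 : (1 : ℝ) ≤ ((k + 1) * radicalBound k d : ℕ) := by
    have : 0 < (k + 1) * radicalBound k d := by unfold radicalBound; positivity
    exact_mod_cast this
  have hC : (approxConst k d : ℝ)
      = ((k + 1) * radicalBound k d : ℕ) * (2 ^ k * (G : ℝ) ^ k) := by
    rw [approxConst, ← hG]
    push_cast
    rw [mul_pow]
  have hmain : (2 : ℝ) ^ K * ((n : ℝ) / G) ^ (-((K : ℝ) / d))
      ≤ 2 ^ k * (G : ℝ) ^ k * (n : ℝ) ^ (-((K : ℝ) / d)) := by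
    rw [Real.div_rpow hn0.le (by positivity), Real.rpow_neg (x := (G : ℝ)) (by positivity),
      div_inv_eq_mul, mul_assoc, mul_comm ((n : ℝ) ^ _)]
    gcongr
    norm_num
  rcases le_or_gt G n with hGn | hGn
  · have hnG : (1 : ℝ) ≤ (n : ℝ) / G := by
      rw [one_le_div (by positivity)]; exact_mod_cast hGn
    set y := ((n : ℝ) / G) ^ ((d : ℝ)⁻¹) with hy
    have hy1 : 1 ≤ y := Real.one_le_rpow hnG (by positivity)
    set N := ⌊y⌋₊ with hNdef
    have hN1 : 1 ≤ N := Nat.one_le_floor_iff _ |>.2 hy1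
    have hNy : (N : ℝ) ≤ y := Nat.floor_le (by linarith)
    have hyN : y < N + 1 := Nat.lt_floor_add_one y
    have hyd : y ^ d = n / G := Real.rpow_inv_natCast_pow (by positivity) (by omega)
    have hNn : N ^ d * G ≤ n := by
      have h1 : (N : ℝ) ^ d ≤ n / G := by rw [← hyd]; gcongr
      rw [le_div_iff₀ (by positivity)] at h1
      exact_mod_cast h1
    obtain ⟨b, hb, hdist⟩ := exists_radical_sum_near hd hm hN1 hNn α
    refine ⟨b, hb, hdist.trans ?_⟩
    rw [hC, mul_assoc]
    refine mul_le_mul_of_nonneg_left (le_trans ?_ hmain) (by positivity)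
    have hN1R : (1 : ℝ) ≤ N := by exact_mod_cast hN1
    have h2 : ((N : ℝ) ^ K)⁻¹ ≤ ((y / 2) ^ K)⁻¹ := by
      gcongr
      linarith
    refine h2.trans (le_of_eq ?_)
    have h3 : ((n : ℝ) / G) ^ ((K : ℝ) / d) = y ^ K := by
      rw [hy, ← Real.rpow_natCast, ← Real.rpow_mul (by positivity)]
      congr 1
      field_simp
    rw [Real.rpow_neg (by positivity), h3, div_pow, inv_div, div_eq_mul_inv]
  · refine ⟨fun _ => 1, fun _ => ⟨le_rfl, hn⟩, ?_⟩
    refine (abs_sub_round _).trans ?_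
    rw [hC, mul_assoc]
    have h1 : 1 ≤ ((n : ℝ) / G) ^ (-((K : ℝ) / d)) :=
      Real.one_le_rpow_of_pos_of_le_one_of_nonpos (by positivity)
        ((div_le_one (by positivity)).2 (by exact_mod_cast hGn.le))
        (neg_nonpos.2 (by positivity))
    have h2 : (1 : ℝ) ≤ 2 ^ K * ((n : ℝ) / G) ^ (-((K : ℝ) / d)) :=
      one_le_mul_of_one_le_of_one_le (one_le_pow₀ (by norm_num)) h1
    have h3 := one_le_mul_of_one_le_of_one_le hA1 (h2.trans hmain)
    linarith

/-! ### The exponent and the conclusion -/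

theorem gammaExp_eq (k d : ℕ) :
    gammaExp k d = ((d : ℝ) ^ Nat.log d (k + 1) - 1) / d := by
  have h : ⌊Real.logb (d : ℝ) ((k : ℝ) + 1)⌋ = (Nat.log d (k + 1) : ℤ) := by
    rw [Real.floor_logb_natCast (by positivity), ← Int.log_natCast (R := ℝ)]
    push_cast; rfl
  rw [gammaExp, h, zpow_natCast]

theorem le_gammaExp {k d : ℕ} (hd : 2 ≤ d) :
    ((k : ℝ) - (d : ℝ) + 1) / (d : ℝ) ^ 2 ≤ gammaExp k d := by
  have hlt : k + 1 < d ^ (Nat.log d (k + 1) + 1) := Nat.lt_pow_succ_log_self (by omega) _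
  have hR : (k : ℝ) + 1 ≤ (d : ℝ) ^ (Nat.log d (k + 1) + 1) := by exact_mod_cast hlt.le
  have hd0 : (0 : ℝ) < d := by exact_mod_cast (by omega : 0 < d)
  rw [gammaExp_eq, div_le_div_iff₀ (by positivity) hd0]
  rw [pow_succ] at hR
  nlinarith [mul_le_mul_of_nonneg_right hR hd0.le]

/-- The constants are effective: `C` is a computable function of the pair `(k, d)`. -/
theorem theorem1p1 :
    ∃ C : ℕ → ℕ → ℕ, Computable₂ C ∧
      (∀ k d : ℕ, 1 ≤ k → 2 ≤ d →
        0 < C k d ∧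
        ((k : ℝ) - (d : ℝ) + 1) / (d : ℝ) ^ 2 ≤ gammaExp k d ∧
        ∀ (α : ℝ) (n : ℕ), 1 ≤ n →
          ∃ b : Fin k → ℕ, (∀ j, 1 ≤ b j ∧ b j ≤ n) ∧
            distNearestInt ((∑ j, (b j : ℝ) ^ ((1 : ℝ) / (d : ℝ))) - α)
              ≤ (C k d : ℝ) * (n : ℝ) ^ (-gammaExp k d)) ∧
      (∀ k : ℕ, 1 ≤ k → ∀ (α : ℝ) (n : ℕ), 1 ≤ n →
        ∃ b : Fin k → ℕ, (∀ j, 1 ≤ b j ∧ b j ≤ n) ∧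
          distNearestInt ((∑ j, Real.sqrt (b j : ℝ)) - α)
            ≤ (C k 2 : ℝ) * (n : ℝ) ^ (-(((k : ℝ) - 1) / 4))) := by
  have hmain : ∀ k d : ℕ, 2 ≤ d → ∀ (α : ℝ) (n : ℕ), 1 ≤ n →
      ∃ b : Fin k → ℕ, (∀ j, 1 ≤ b j ∧ b j ≤ n) ∧
        distNearestInt ((∑ j, (b j : ℝ) ^ ((1 : ℝ) / (d : ℝ))) - α)
          ≤ (approxConst k d : ℝ) * (n : ℝ) ^ (-gammaExp k d) := by
    intro k d hd α n hn
    rw [gammaExp_eq]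
    exact exists_radical_sum_near_rpow hd (Nat.pow_log_le_self d (Nat.succ_ne_zero k)) hn α
  refine ⟨approxConst, computable₂_approxConst, fun k d _ hd => ⟨?_, le_gammaExp hd, hmain k d hd⟩,
    fun k _ α n hn => ?_⟩
  · have := rangeThreshold_pos k d
    unfold approxConst radicalBound
    positivity
  · obtain ⟨b, hb, hdist⟩ := hmain k 2 le_rfl α n hn
    refine ⟨b, hb, ?_⟩
    simp only [Real.sqrt_eq_rpow]
    push_cast at hdist
    refine hdist.trans (mul_le_mul_of_nonneg_left ?_ (Nat.cast_nonneg _))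
    refine Real.rpow_le_rpow_of_exponent_le (by exact_mod_cast hn) (neg_le_neg ?_)
    -- At `d = 2` the lower bound `(k-d+1)/d²` is exactly `(k-1)/4`.
    refine le_trans (le_of_eq ?_) (le_gammaExp le_rfl)
    push_cast
    ring
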